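/- Let $n\ge 1$, let $W\sim\mathcal N(0,I_n)$, and for a positive semidefinite $\Sigma_X\in\mathbb R^{n\times n}$ with eigenvalues $\lambda_1,\dots,\lambda_n\ge 0$ put $d_{\Sigma_X}(w,v)=(w-v)^\top\Sigma_X(w-v)$ for $w,v\in\mathbb R^n$. A compression scheme of rate $R$ consists of a measurable encoder $f:\mathbb R^n\to\{1,\dots,\lfloor 2^{nR}\rfloor\}$ and a decoder $g:\{1,\dots,\lfloor 2^{nR}\rfloor\}\to\mathbb R^n$; both may depend on $\Sigma_X$. Write $\log=\log_2$ and, for $t>0$, $$D_{\mathrm{wf}}(\Sigma_X,t)=\frac1n\sum_{i=1}^n\min\{\lambda_i,t\},\qquad R_{\mathrm{wf}}(\Sigma_X,t)=\frac1{2n}\sum_{i=1}^n\max\Big\{0,\log\frac{\lambda_i}{t}\Big\}$$ (with $\log 0=-\infty$). The waterfilling distortion is $\mathbf D_{\mathrm{wf}}(R,\Sigma_X)=D_{\mathrm{wf}}(\Sigma_X,t)$ for any $t>0$ with $R_{\mathrm{wf}}(\Sigma_X,t)=R$ (the value does not depend on the choice of $t$); if there is no such $t$, which happens only if $R<0$ or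 $\Sigma_X=0$, then $\mathbf D_{\mathrm{wf}}(R,\Sigma_X)=\frac1n\operatorname{tr}\Sigma_X$. (i) For every $n\ge1$, every positive semidefinite $\Sigma_X$, every $R$ and every compression scheme $(f,g)$ of rate $R$, $$\mathbb E\big[d_{\Sigma_X}(W,g(f(W)))\big]\ \ge\ n\,\mathbf D_{\mathrm{wf}}(R,\Sigma_X).$$ (ii) Conversely, for every $B>0$ there is a constant $c=c(B)>0$ such that for every $n\ge1$, every $R\ge0$ and every positive semidefinite $\Sigma_X\in\mathbb R^{n\times n}$ there is a compression scheme $(f,g)$ of rate $R$ (depending on $\Sigma_X$) with $$\mathbb E\big[d_{\Sigma_X}(W,g(f(W)))\big]\ \le\ n\,\mathbf D_{\mathrm{wf}}\Big(R-c\sqrt{\tfrac{\log n}{n}},\ \Sigma_X\Big)+c\,n^{-B}\operatorname{tr}\Sigma_X.$$ -/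

import Mathlib

open MeasureTheory ProbabilityTheory
open scoped Matrix

noncomputable section

/-- The quadratic distortion `d_Σ(w, v) = (w - v)ᵀ Σ (w - v)` on `ℝⁿ`. -/
def quadDist {n : ℕ} (S : Matrix (Fin n) (Fin n) ℝ) (w v : EuclideanSpace ℝ (Fin n)) : ℝ :=
  (fun i => w i - v i) ⬝ᵥ (S *ᵥ (fun i => w i - v i))

/-- An `(n, R)` quantization scheme: a (measurable) encoder `f : ℝⁿ → [2^{nR}]` and a decoder
`g : [2^{nR}] → ℝⁿ`, where `[x] = {1, …, ⌊x⌋}` is modelled by `Fin ⌊x⌋₊`. The rate `R` is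
measured in bits per coordinate. -/
structure QuantScheme (n : ℕ) (R : ℝ) where
  /-- the encoder `f` -/
  enc : EuclideanSpace ℝ (Fin n) → Fin ⌊(2 : ℝ) ^ ((n : ℝ) * R)⌋₊
  /-- the decoder `g` -/
  dec : Fin ⌊(2 : ℝ) ^ ((n : ℝ) * R)⌋₊ → EuclideanSpace ℝ (Fin n)
  measurable_enc : Measurable enc

/-- The expected distortion `𝔼[d_Σ(W, g(f(W)))]` with `W ∼ N(0, I_n)`. The integrand is
integrable whenever `Σ` is positive semidefinite, see `integrable_quadDist_scheme`. -/
def QuantScheme.expDist {n : ℕ} {R : ℝ} (q : QuantScheme n R)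
    (S : Matrix (Fin n) (Fin n) ℝ) : ℝ :=
  ∫ w, quadDist S w (q.dec (q.enc w)) ∂(stdGaussian (EuclideanSpace ℝ (Fin n)))

/-- The distortion `(1/n) ∑ᵢ min {λᵢ, t}` at water level `t`. -/
def wfDistAt {n : ℕ} {S : Matrix (Fin n) (Fin n) ℝ} (hS : S.PosSemidef) (t : ℝ) : ℝ :=
  (1 / (n : ℝ)) * ∑ i, min (hS.isHermitian.eigenvalues i) t

/-- The rate `(1/(2n)) ∑ᵢ max {0, log₂ (λᵢ / t)}` at water level `t > 0`. (For `λᵢ = 0` the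
summand is `0`, in accordance with `log 0 = -∞`.) -/
def wfRateAt {n : ℕ} {S : Matrix (Fin n) (Fin n) ℝ} (hS : S.PosSemidef) (t : ℝ) : ℝ :=
  (1 / (2 * (n : ℝ))) * ∑ i, max 0 (Real.logb 2 (hS.isHermitian.eigenvalues i / t))

open Classical in
/-- The waterfilling distortion as a function of the rate: the distortion at a water level `t > 0`
whose rate is `R`; it does not depend on the choice of `t`, see `wfDist_eq`. A level fails to exist
only if `R < 0`, or if `Σ = 0` and `R ≠ 0`; the value is then `tr Σ / n`, the distortion at rate
zero (in particular it is `0` for `Σ = 0`). -/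
def wfDist {n : ℕ} (R : ℝ) {S : Matrix (Fin n) (Fin n) ℝ} (hS : S.PosSemidef) : ℝ :=
  if h : ∃ t : ℝ, 0 < t ∧ wfRateAt hS t = R then wfDistAt hS h.choose else S.trace / n

end

theorem wfDistAt_eq_of_wfRateAt_eq {n : ℕ} {S : Matrix (Fin n) (Fin n) ℝ} (hS : S.PosSemidef)
    {s t : ℝ} (hs : 0 < s) (hst : s ≤ t) (h : wfRateAt hS s = wfRateAt hS t) :
    wfDistAt hS s = wfDistAt hS t := by
  rcases Nat.eq_zero_or_pos n with rfl | hn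
  · simp [wfDistAt]
  have ht : 0 < t := hs.trans_le hst
  have hn' : (0 : ℝ) < n := by exact_mod_cast hn
  unfold wfRateAt at h
  have h' := mul_left_cancel₀ (by positivity) h
  have hmono : ∀ i ∈ Finset.univ, max 0 (Real.logb 2 (hS.isHermitian.eigenvalues i / t)) ≤
      max 0 (Real.logb 2 (hS.isHermitian.eigenvalues i / s)) := by
    intro i _
    rcases (hS.eigenvalues_nonneg i).eq_or_lt with h0 | h0
    · simp [← h0]
    · exact max_le_max le_rfl (Real.logb_le_logb_of_le one_lt_two (by positivity) (by gcongr))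
  have heq := (Finset.sum_eq_sum_iff_of_le hmono).1 h'.symm
  unfold wfDistAt
  congr 1
  refine Finset.sum_congr rfl fun i hi => ?_
  have hi' := heq i hi
  rcases le_or_gt (hS.isHermitian.eigenvalues i) s with hle | hgt
  · rw [min_eq_left hle, min_eq_left (hle.trans hst)]
  · have h0 : 0 < hS.isHermitian.eigenvalues i := hs.trans hgt
    have hpos : 0 < Real.logb 2 (hS.isHermitian.eigenvalues i / s) :=
      Real.logb_pos one_lt_two ((one_lt_div hs).2 hgt)
    rw [max_eq_right hpos.le] at hi'
    have hpos' : 0 < Real.logb 2 (hS.isHermitian.eigenvalues i / t) := by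
      by_contra hcon
      rw [max_eq_left (not_lt.1 hcon)] at hi'
      exact hpos.ne hi'
    rw [max_eq_right hpos'.le] at hi'
    have := Real.logb_injOn_pos one_lt_two (Set.mem_Ioi.2 (div_pos h0 ht))
      (Set.mem_Ioi.2 (div_pos h0 hs)) hi'
    have hst' : t = s := by
      field_simp at this
      linarith
    rw [hst']

/-- `wfDist` is well defined: every water level of rate `R` gives the same distortion. -/
theorem wfDist_eq {n : ℕ} {R : ℝ} {S : Matrix (Fin n) (Fin n) ℝ} (hS : S.PosSemidef)
    {t : ℝ} (ht : 0 < t) (h : wfRateAt hS t = R) : wfDist R hS = wfDistAt hS t := by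
  have hex : ∃ t : ℝ, 0 < t ∧ wfRateAt hS t = R := ⟨t, ht, h⟩
  rw [wfDist, dif_pos hex]
  obtain ⟨h1, h2⟩ := hex.choose_spec
  rcases le_total hex.choose t with hle | hle
  · exact wfDistAt_eq_of_wfRateAt_eq hS h1 hle (h2.trans h.symm)
  · exact (wfDistAt_eq_of_wfRateAt_eq hS ht hle (h.trans h2.symm)).symm

theorem quadDist_nonneg {n : ℕ} {S : Matrix (Fin n) (Fin n) ℝ} (hS : S.PosSemidef)
    (w v : EuclideanSpace ℝ (Fin n)) : 0 ≤ quadDist S w v := by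
  simpa [quadDist] using hS.dotProduct_mulVec_nonneg (fun i => w i - v i)

theorem integrable_quadDist {n : ℕ} (S : Matrix (Fin n) (Fin n) ℝ)
    (v : EuclideanSpace ℝ (Fin n)) :
    Integrable (fun w => quadDist S w v) (stdGaussian (EuclideanSpace ℝ (Fin n))) := by
  have hL : ∀ i, MemLp (fun w : EuclideanSpace ℝ (Fin n) => w i - v i) 2
      (stdGaussian (EuclideanSpace ℝ (Fin n))) := fun i =>
    (IsGaussian.memLp_dual (stdGaussian (EuclideanSpace ℝ (Fin n)))
      (EuclideanSpace.proj i) 2 (by simp)).sub (memLp_const (v i))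
  simp only [quadDist, dotProduct, Matrix.mulVec, Finset.mul_sum]
  refine integrable_finsetSum _ fun i _ => integrable_finsetSum _ fun j _ => ?_
  have := ((hL i).integrable_mul (hL j)).const_mul (S i j)
  refine this.congr (Filter.Eventually.of_forall fun w => ?_)
  simp only [Pi.mul_apply]
  ring

theorem integrable_quadDist_scheme {n : ℕ} {R : ℝ} {S : Matrix (Fin n) (Fin n) ℝ}
    (hS : S.PosSemidef) (q : QuantScheme n R) :
    Integrable (fun w => quadDist S w (q.dec (q.enc w)))
      (stdGaussian (EuclideanSpace ℝ (Fin n))) := by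
  have hm : Measurable fun w => q.dec (q.enc w) :=
    (measurable_of_countable q.dec).comp q.measurable_enc
  refine (integrable_finsetSum Finset.univ fun m _ => integrable_quadDist S (q.dec m)).mono'
    (Measurable.aestronglyMeasurable ?_) (Filter.Eventually.of_forall fun w => ?_)
  · simp only [quadDist, dotProduct, Matrix.mulVec]
    fun_prop
  · rw [Real.norm_of_nonneg (quadDist_nonneg hS _ _)]
    exact Finset.single_le_sum (f := fun m => quadDist S w (q.dec m))
      (fun m _ => quadDist_nonneg hS _ _) (Finset.mem_univ (q.enc w))

/-! In an eigenbasis of `S` the Gaussian vector stays standard and the distortion becomes `∑ λᵢ (wᵢ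
- vᵢ)²`.

Converse (`wfDistAt_le_expDist`): fix a level `t` of rate `R` and put `rᵢ = λᵢ / t`. For each
reproduction point `y`, the exponential of `∑ waterTilt (rᵢ) (xᵢ) (yᵢ)` has Gaussian mean at most
`1`. Let `u` be this sum at the point actually decoded. A sum over the `N` messages gives `𝔼 exp u ≤
N`, so by convexity `𝔼 u ≤ log N ≤ n R log 2`. The tilt is chosen so that `𝔼 u = n R log 2 + (∑ min
λᵢ t - 𝔼 d) / (2t)`, and the claim follows. The tilt plays the role of a dual certificate; no mutual
information is needed.

Achievability (`exists_codebook_at_level`): write `w = √(1-s) u + √s v` with `sᵢ` slightly below `t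
/ λᵢ` where `λᵢ > t`, and `sᵢ = 1` elsewhere. By chi-squared concentration the distortion and the
information density are under control, the latter up to `O(√(n log n))` nats, except with
probability `O(n^(-2B))`. Averaging over `u` then yields, for any set `F` not yet covered, a
codeword that captures a `K⁻¹`-fraction of the excess mass of `F`
(`exists_codeword_of_testChannel`). About `K log n` greedy choices therefore suffice
(`exists_greedy_covering`), and the rate surplus `c √(log n / n)` pays for the deviation and for the
factor `log n`. Uncovered points are decoded to `0` and cost `O(n^(-B)) tr S` by a fourth moment
bound (`integral_codebook_le`). -/

open scoped NNReal ENNReal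

/-! ### Eigencoordinates and existence of water levels. -/

/-- The law of `n` independent standard Gaussian variables, as a measure on `Fin n → ℝ`. -/
noncomputable abbrev piGaussian (n : ℕ) : Measure (Fin n → ℝ) :=
  Measure.pi fun _ => gaussianReal 0 1

/-- In coordinates with respect to an eigenbasis of `S`, the standard Gaussian measure is a product
measure and the distortion is a weighted sum of squares. -/
theorem exists_measurableEquiv_quadDist {n : ℕ} {S : Matrix (Fin n) (Fin n) ℝ}
    (hS : S.PosSemidef) :
    ∃ e : EuclideanSpace ℝ (Fin n) ≃ᵐ (Fin n → ℝ),
      MeasurePreserving e (stdGaussian (EuclideanSpace ℝ (Fin n))) (piGaussian n) ∧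
      ∀ w v, quadDist S w v = ∑ i, hS.isHermitian.eigenvalues i * (e w i - e v i) ^ 2 := by
  set b := hS.isHermitian.eigenvectorBasis with hb
  let e : EuclideanSpace ℝ (Fin n) ≃ᵐ (Fin n → ℝ) :=
    b.repr.toHomeomorph.toMeasurableEquiv.trans (MeasurableEquiv.toLp 2 (Fin n → ℝ)).symm
  have he : ∀ w i, e w i = b.repr w i := fun w i => rfl
  refine ⟨e, ⟨e.measurable, ?_⟩, fun w v => ?_⟩
  · have h1 : (stdGaussian (EuclideanSpace ℝ (Fin n))).map b.repr =
        (piGaussian n).map (MeasurableEquiv.toLp 2 (Fin n → ℝ)) := by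
      rw [stdGaussian_map b.repr, MeasurableEquiv.coe_toLp, map_pi_eq_stdGaussian]
    have h2 : ⇑e = (MeasurableEquiv.toLp 2 (Fin n → ℝ)).symm ∘ b.repr := rfl
    rw [h2, ← Measure.map_map (MeasurableEquiv.measurable _) b.repr.continuous.measurable, h1,
      Measure.map_map (MeasurableEquiv.measurable _) (MeasurableEquiv.measurable _)]
    simp
  · have hx : ∀ x : EuclideanSpace ℝ (Fin n), x.ofLp ⬝ᵥ (S *ᵥ x.ofLp) =
        ∑ i, hS.isHermitian.eigenvalues i * (b.repr x i) ^ 2 := by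
      intro x
      have h1 : x.ofLp ⬝ᵥ (S *ᵥ x.ofLp) = inner ℝ x (Matrix.toEuclideanLin S x) := by
        simp [PiLp.inner_apply, dotProduct, Matrix.toLpLin_apply, mul_comm]
      rw [h1, ← b.sum_inner_mul_inner]
      refine Finset.sum_congr rfl fun i _ => ?_
      have h2 : inner ℝ (b i) (Matrix.toEuclideanLin S x) =
          hS.isHermitian.eigenvalues i * inner ℝ (b i) x := by
        rw [← (Matrix.isSymmetric_toEuclideanLin_iff.mpr hS.isHermitian) (b i) x]
        have : Matrix.toEuclideanLin S (b i) = hS.isHermitian.eigenvalues i • b i := by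
          have := hS.isHermitian.mulVec_eigenvectorBasis i
          ext j
          simpa [Matrix.toLpLin_apply] using congrFun this j
        rw [this, real_inner_smul_left]
      rw [h2, b.repr_apply_apply, real_inner_comm]
      ring
    have h := hx (w - v)
    rw [map_sub] at h
    exact h

theorem trace_eq_sum_eigenvalues_of_posSemidef {n : ℕ} {S : Matrix (Fin n) (Fin n) ℝ}
    (hS : S.PosSemidef) : S.trace = ∑ i, hS.isHermitian.eigenvalues i := by
  simpa using hS.isHermitian.trace_eq_sum_eigenvalues

theorem continuousOn_wfRateAt {n : ℕ} {S : Matrix (Fin n) (Fin n) ℝ} (hS : S.PosSemidef) :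
    ContinuousOn (wfRateAt hS) (Set.Ioi 0) := by
  unfold wfRateAt
  refine continuousOn_const.mul (continuousOn_finsetSum _ fun i _ => ?_)
  rcases (hS.eigenvalues_nonneg i).eq_or_lt with h0 | h0
  · simp only [← h0, zero_div, Real.logb_zero]
    exact continuousOn_const
  · refine continuousOn_const.sup (ContinuousOn.logb ?_ fun t ht => ?_)
    · exact continuousOn_const.div continuousOn_id fun t ht => ne_of_gt ht
    · exact ne_of_gt (div_pos h0 ht)

/-- A water level of rate `R` exists for every `R ≥ 0`, provided that some eigenvalue is positive. -/
theorem exists_wfRateAt_eq {n : ℕ} {S : Matrix (Fin n) (Fin n) ℝ} (hS : S.PosSemidef)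
    {R : ℝ} (hR : 0 ≤ R) {j : Fin n} (hj : 0 < hS.isHermitian.eigenvalues j) :
    ∃ t, 0 < t ∧ wfRateAt hS t = R := by
  have hn : 0 < (n : ℝ) := by exact_mod_cast j.pos
  set l := hS.isHermitian.eigenvalues with hl
  set T := ∑ i, l i with hT
  have hlT : ∀ i, l i ≤ T := fun i =>
    Finset.single_le_sum (f := l) (fun i _ => hS.eigenvalues_nonneg i) (Finset.mem_univ i)
  have hTpos : 0 < T := hj.trans_le (hlT j)
  -- At level `t₀` the coordinate `j` alone already accounts for rate `R`; at level `T` the rate is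
  -- `0`. The intermediate value theorem applies between them.
  set t₀ := l j * 2 ^ (-(2 * n * R)) with ht₀
  have ht₀pos : 0 < t₀ := by positivity
  have ht₀T : t₀ ≤ T := by
    refine le_trans ?_ (hlT j)
    refine mul_le_of_le_one_right hj.le ?_
    refine Real.rpow_le_one_of_one_le_of_nonpos one_le_two ?_
    have : 0 ≤ 2 * n * R := by positivity
    linarith
  have hrT : wfRateAt hS T ≤ R := by
    unfold wfRateAt
    rw [Finset.sum_eq_zero]
    · simpa using hR
    · intro i _
      refine max_eq_left ?_
      refine Real.logb_nonpos one_lt_two (div_nonneg (hS.eigenvalues_nonneg i) hTpos.le) ?_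
      exact (div_le_one hTpos).2 (hlT i)
  have hr₀ : R ≤ wfRateAt hS t₀ := by
    have h1 : Real.logb 2 (l j / t₀) = 2 * n * R := by
      have : l j / t₀ = 2 ^ (2 * n * R) := by
        rw [ht₀, Real.rpow_neg zero_le_two]
        field_simp
      rw [this, Real.logb_rpow (by norm_num) (by norm_num)]
    have h2 : 2 * n * R ≤ ∑ i, max 0 (Real.logb 2 (l i / t₀)) := by
      rw [← h1]
      refine (le_max_right 0 _).trans ?_
      exact Finset.single_le_sum (f := fun i => max 0 (Real.logb 2 (l i / t₀)))
        (fun i _ => le_max_left _ _) (Finset.mem_univ j)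
    unfold wfRateAt
    calc R = 1 / (2 * n) * (2 * n * R) := by field_simp
      _ ≤ _ := by gcongr
  obtain ⟨t, ht, htR⟩ := intermediate_value_Icc' ht₀T
    ((continuousOn_wfRateAt hS).mono fun t ht => ht₀pos.trans_le ht.1) ⟨hrT, hr₀⟩
  exact ⟨t, ht₀pos.trans_le ht.1, htR⟩

/-! ### Gaussian density ratios. -/

/-- The density of `gaussianReal y s` with respect to `gaussianReal 0 1`. -/
noncomputable def gaussianRatio (y : ℝ) (s : ℝ≥0) (x : ℝ) : ℝ :=
  (√s)⁻¹ * Real.exp (x ^ 2 / 2 - (x - y) ^ 2 / (2 * s))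

theorem gaussianRatio_nonneg (y : ℝ) (s : ℝ≥0) (x : ℝ) : 0 ≤ gaussianRatio y s x := by
  unfold gaussianRatio
  positivity

theorem measurable_gaussianRatio (y : ℝ) (s : ℝ≥0) : Measurable (gaussianRatio y s) := by
  unfold gaussianRatio
  fun_prop

theorem gaussianReal_eq_withDensity (y : ℝ) {s : ℝ≥0} (hs : s ≠ 0) :
    gaussianReal y s =
      (gaussianReal 0 1).withDensity fun x => ENNReal.ofReal (gaussianRatio y s x) := by
  rw [gaussianReal_of_var_ne_zero _ hs, gaussianReal_of_var_ne_zero _ one_ne_zero,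
    ← withDensity_mul _ (measurable_gaussianPDF _ _)
      (measurable_gaussianRatio y s).ennreal_ofReal]
  congr 1
  ext x
  rw [Pi.mul_apply, gaussianPDF, gaussianPDF, ← ENNReal.ofReal_mul (gaussianPDFReal_nonneg _ _ _)]
  congr 1
  have hpi : √(2 * Real.pi) ≠ 0 := by positivity
  have hs' : √(s : ℝ) ≠ 0 := by positivity
  simp only [gaussianPDFReal, gaussianRatio, NNReal.coe_one, mul_one, sub_zero]
  rw [Real.sqrt_mul (by positivity), mul_inv]
  have : Real.exp (-(x - y) ^ 2 / (2 * s)) =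
      Real.exp (-x ^ 2 / 2) * Real.exp (x ^ 2 / 2 - (x - y) ^ 2 / (2 * s)) := by
    rw [← Real.exp_add]
    ring_nf
  rw [this]
  ring

theorem lintegral_gaussianRatio (y : ℝ) {s : ℝ≥0} (hs : s ≠ 0) :
    ∫⁻ x, ENNReal.ofReal (gaussianRatio y s x) ∂gaussianReal 0 1 = 1 := by
  have h : gaussianReal y s Set.univ = 1 := measure_univ
  rwa [gaussianReal_eq_withDensity y hs, withDensity_apply _ MeasurableSet.univ,
    Measure.restrict_univ] at h

theorem integrable_gaussianRatio (y : ℝ) {s : ℝ≥0} (hs : s ≠ 0) :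
    Integrable (gaussianRatio y s) (gaussianReal 0 1) := by
  refine ⟨(measurable_gaussianRatio y s).aestronglyMeasurable, ?_⟩
  rw [hasFiniteIntegral_iff_ofReal (Filter.Eventually.of_forall (gaussianRatio_nonneg y s)),
    lintegral_gaussianRatio y hs]
  exact ENNReal.one_lt_top

theorem integral_gaussianRatio (y : ℝ) {s : ℝ≥0} (hs : s ≠ 0) :
    ∫ x, gaussianRatio y s x ∂gaussianReal 0 1 = 1 := by
  rw [integral_eq_lintegral_of_nonneg_ae
    (Filter.Eventually.of_forall (gaussianRatio_nonneg y s))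
    (measurable_gaussianRatio y s).aestronglyMeasurable, lintegral_gaussianRatio y hs]
  simp

/-! ### The converse. -/

/-- The logarithm of the tilting function that certifies the waterfilling bound in a coordinate
with signal-to-distortion ratio `r`. -/
noncomputable def waterTilt (r x y : ℝ) : ℝ :=
  (max 0 (Real.log r) + min 1 r * x ^ 2 - r * (x - y) ^ 2) / 2

/-- For `r ≥ 1` the function is exactly the density of `N(y, 1/r)` relative to `N(0, 1)`, so the
integral is `1`. For `r ≤ 1` the quadratic terms in `x` cancel, and the moment generating function
gives `exp (-r (1 - r) y² / 2)`. -/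
theorem integrable_exp_waterTilt_and_integral_le {r : ℝ} (hr : 0 ≤ r) (y : ℝ) :
    Integrable (fun x => Real.exp (waterTilt r x y)) (gaussianReal 0 1) ∧
      ∫ x, Real.exp (waterTilt r x y) ∂gaussianReal 0 1 ≤ 1 := by
  rcases le_total r 1 with h1 | h1
  · have hfun : (fun x => Real.exp (waterTilt r x y)) =
        fun x => Real.exp (-(r * y ^ 2 / 2)) * Real.exp (r * y * x) := by
      ext x
      rw [← Real.exp_add, waterTilt, max_eq_left (Real.log_nonpos hr h1), min_eq_right h1]
      ring_nf
    have hmgf : ∫ x, Real.exp (r * y * x) ∂gaussianReal 0 1 = Real.exp ((r * y) ^ 2 / 2) := by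
      have := congrFun (mgf_fun_id_gaussianReal (μ := 0) (v := 1)) (r * y)
      simpa [mgf] using this
    rw [hfun]
    refine ⟨(integrable_exp_mul_gaussianReal _).const_mul _, ?_⟩
    rw [integral_const_mul, hmgf, ← Real.exp_add, Real.exp_le_one_iff]
    nlinarith [mul_nonneg (mul_nonneg hr (sub_nonneg.2 h1)) (sq_nonneg y)]
  · have hr0 : 0 < r := one_pos.trans_le h1
    lift r to ℝ≥0 using hr
    have hr0' : r⁻¹ ≠ 0 := inv_ne_zero (by exact_mod_cast hr0.ne')
    have hfun : (fun x => Real.exp (waterTilt r x y)) = gaussianRatio y r⁻¹ := by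
      ext x
      rw [waterTilt, gaussianRatio, max_eq_right (Real.log_nonneg h1), min_eq_left h1]
      have : (√((r⁻¹ : ℝ≥0) : ℝ))⁻¹ = Real.exp (Real.log r / 2) := by
        rw [NNReal.coe_inv, Real.sqrt_inv, inv_inv, ← Real.log_sqrt hr0.le, Real.exp_log]
        positivity
      rw [this, ← Real.exp_add]
      congr 1
      push_cast
      field_simp
      ring
    rw [hfun]
    exact ⟨integrable_gaussianRatio y hr0', (integral_gaussianRatio y hr0').le⟩

theorem integrable_exp_sum_waterTilt_and_integral_le {n : ℕ} {r : Fin n → ℝ} (hr : ∀ i, 0 ≤ r i)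
    (y : Fin n → ℝ) :
    Integrable (fun x => Real.exp (∑ i, waterTilt (r i) (x i) (y i))) (piGaussian n) ∧
      ∫ x, Real.exp (∑ i, waterTilt (r i) (x i) (y i)) ∂piGaussian n ≤ 1 := by
  simp_rw [Real.exp_sum]
  refine ⟨Integrable.fintype_prod (f := fun i x => Real.exp (waterTilt (r i) x (y i)))
    fun i => (integrable_exp_waterTilt_and_integral_le (hr i) (y i)).1, ?_⟩
  rw [integral_fintype_prod_eq_prod fun i x => Real.exp (waterTilt (r i) x (y i))]
  exact Finset.prod_le_one (fun i _ => integral_nonneg fun x => (Real.exp_pos _).le)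
    fun i _ => (integrable_exp_waterTilt_and_integral_le (hr i) (y i)).2

theorem integral_sq_gaussianReal : ∫ x, x ^ 2 ∂gaussianReal 0 1 = 1 := by
  have h := variance_id_gaussianReal (μ := 0) (v := 1)
  rw [variance_of_integral_eq_zero aemeasurable_id (by simp)] at h
  simpa using h

theorem integrable_pow_gaussianReal (k : ℕ) :
    Integrable (fun x => x ^ k) (gaussianReal 0 1) := by
  have h := (memLp_id_gaussianReal (μ := 0) (v := 1) (k : ℝ≥0)).integrable_norm_pow'
  refine (integrable_norm_iff (by fun_prop)).1 ?_
  simpa using h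

theorem integrable_eval_pow_piGaussian {n : ℕ} (k : ℕ) (i : Fin n) :
    Integrable (fun x : Fin n → ℝ => x i ^ k) (piGaussian n) :=
  integrable_comp_eval (μ := fun _ : Fin n => gaussianReal 0 1) (i := i)
    (f := fun x => x ^ k) (integrable_pow_gaussianReal k)

theorem integral_eval_piGaussian {n : ℕ} (i : Fin n) {f : ℝ → ℝ} (hf : Measurable f) :
    ∫ x : Fin n → ℝ, f (x i) ∂piGaussian n = ∫ x, f x ∂gaussianReal 0 1 :=
  integral_comp_eval (μ := fun _ : Fin n => gaussianReal 0 1) (i := i) (f := f)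
    hf.aestronglyMeasurable

theorem sum_max_zero_log_eq {n : ℕ} (hn : 0 < n) {S : Matrix (Fin n) (Fin n) ℝ}
    (hS : S.PosSemidef) (t : ℝ) :
    ∑ i, max 0 (Real.log (hS.isHermitian.eigenvalues i / t)) / 2 =
      n * wfRateAt hS t * Real.log 2 := by
  have hn' : (0 : ℝ) < n := by exact_mod_cast hn
  have h : ∀ x, max 0 (Real.log x) = max 0 (Real.logb 2 x) * Real.log 2 := by
    intro x
    rw [max_mul_of_nonneg _ _ (Real.log_nonneg one_le_two), zero_mul, Real.logb,
      div_mul_cancel₀ _ (Real.log_pos one_lt_two).ne']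
  simp_rw [h]
  rw [← Finset.sum_div, ← Finset.sum_mul, wfRateAt]
  field_simp

/-- The converse at a given water level: a scheme of rate at most that of the level `t` has
distortion at least that of the level `t`. -/
theorem wfDistAt_le_expDist {n : ℕ} (hn : 0 < n) {R t : ℝ} {S : Matrix (Fin n) (Fin n) ℝ}
    (hS : S.PosSemidef) (ht : 0 < t) (hR : wfRateAt hS t = R) (q : QuantScheme n R) :
    (n : ℝ) * wfDistAt hS t ≤ q.expDist S := by
  obtain ⟨e, he, hd⟩ := exists_measurableEquiv_quadDist hS
  have hn' : (0 : ℝ) < n := by exact_mod_cast hn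
  set l := hS.isHermitian.eigenvalues with hl
  have hl0 : ∀ i, 0 ≤ l i := fun i => hS.eigenvalues_nonneg i
  set r : Fin n → ℝ := fun i => l i / t with hr
  have hr0 : ∀ i, 0 ≤ r i := fun i => div_nonneg (hl0 i) ht.le
  set N := ⌊(2 : ℝ) ^ ((n : ℝ) * R)⌋₊ with hN
  set P := stdGaussian (EuclideanSpace ℝ (Fin n)) with hP
  have hNpos : 0 < N := (q.enc 0).pos
  have hN' : (0 : ℝ) < N := by exact_mod_cast hNpos
  have hlogN : Real.log N ≤ n * R * Real.log 2 := by
    have h1 : (N : ℝ) ≤ 2 ^ ((n : ℝ) * R) := Nat.floor_le (by positivity)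
    calc Real.log N ≤ Real.log (2 ^ ((n : ℝ) * R)) := Real.log_le_log hN' h1
      _ = _ := Real.log_rpow two_pos _
  set U : Fin N → EuclideanSpace ℝ (Fin n) → ℝ := fun m w =>
    ∑ i, waterTilt (r i) (e w i) (e (q.dec m) i) with hU
  have hUint : ∀ m, Integrable (fun w => Real.exp (U m w)) P ∧ ∫ w, Real.exp (U m w) ∂P ≤ 1 := by
    intro m
    obtain ⟨h1, h2⟩ := integrable_exp_sum_waterTilt_and_integral_le hr0 (e (q.dec m))
    refine ⟨he.integrable_comp_of_integrable h1, ?_⟩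
    rw [← he.integral_comp' (f := e)] at h2
    exact h2
  set u : EuclideanSpace ℝ (Fin n) → ℝ := fun w => U (q.enc w) w with hu
  have hu_eq : ∀ w, u w = n * R * Real.log 2 + (∑ i, min (l i) t * (e w i) ^ 2) / (2 * t) -
      quadDist S w (q.dec (q.enc w)) / (2 * t) := by
    intro w
    have h1 : n * R * Real.log 2 = ∑ i, max 0 (Real.log (r i)) / 2 := by
      rw [← hR]
      exact (sum_max_zero_log_eq hn hS t).symm
    rw [h1, hd, hu, hU, Finset.sum_div, Finset.sum_div, ← Finset.sum_add_distrib,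
      ← Finset.sum_sub_distrib]
    refine Finset.sum_congr rfl fun i _ => ?_
    have h2 : min 1 (r i) = min (l i) t / t := by
      rw [min_comm, ← min_div_div_right ht.le, div_self ht.ne']
    rw [waterTilt, h2, hr]
    field_simp
  have hmeas : Measurable u := by
    rw [funext hu_eq]
    have hm : Measurable fun w => q.dec (q.enc w) :=
      (measurable_of_countable q.dec).comp q.measurable_enc
    have h1 : ∀ i, Measurable fun w => e w i := fun i =>
      (measurable_pi_apply i).comp e.measurable
    have h2 : Measurable fun w => quadDist S w (q.dec (q.enc w)) := by
      simp only [quadDist, dotProduct, Matrix.mulVec]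
      fun_prop
    fun_prop
  have hsum : Integrable (fun w => ∑ m, Real.exp (U m w)) P :=
    integrable_finsetSum _ fun m _ => (hUint m).1
  have hle : ∀ w, Real.exp (u w) ≤ ∑ m, Real.exp (U m w) := fun w =>
    Finset.single_le_sum (f := fun m => Real.exp (U m w)) (fun m _ => (Real.exp_pos _).le)
      (Finset.mem_univ (q.enc w))
  -- Only the number of messages matters: the term of the chosen message is at most the sum over all
  -- messages, each of mean at most `1`.
  have hexp : ∫ w, Real.exp (u w) ∂P ≤ N := by
    calc ∫ w, Real.exp (u w) ∂P ≤ ∫ w, ∑ m, Real.exp (U m w) ∂P :=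
          integral_mono_of_nonneg (Filter.Eventually.of_forall fun w => (Real.exp_pos _).le) hsum
            (Filter.Eventually.of_forall hle)
      _ = ∑ m, ∫ w, Real.exp (U m w) ∂P := integral_finsetSum _ fun m _ => (hUint m).1
      _ ≤ ∑ _m : Fin N, (1 : ℝ) := Finset.sum_le_sum fun m _ => (hUint m).2
      _ = N := by simp
  have hexpint : Integrable (fun w => Real.exp (u w)) P :=
    hsum.mono' (by fun_prop) (Filter.Eventually.of_forall fun w => by
      rw [Real.norm_of_nonneg (Real.exp_pos _).le]; exact hle w)
  have hsq : ∀ i, Integrable (fun w => (e w i) ^ 2) P := fun i =>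
    he.integrable_comp_of_integrable (integrable_eval_pow_piGaussian 2 i)
  have hsqv : ∀ i, ∫ w, (e w i) ^ 2 ∂P = 1 := by
    intro i
    rw [he.integral_comp' (f := e) (fun x => x i ^ 2),
      integral_eval_piGaussian i (f := fun x => x ^ 2) (by fun_prop), integral_sq_gaussianReal]
  have hA : Integrable (fun w => (∑ i, min (l i) t * (e w i) ^ 2) / (2 * t)) P :=
    (integrable_finsetSum _ fun i _ => (hsq i).const_mul _).div_const _
  have hD : Integrable (fun w => quadDist S w (q.dec (q.enc w)) / (2 * t)) P :=
    (integrable_quadDist_scheme hS q).div_const _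
  have hCA : Integrable (fun w => n * R * Real.log 2 +
      (∑ i, min (l i) t * (e w i) ^ 2) / (2 * t)) P := (integrable_const _).add hA
  have huint : Integrable u P := by
    rw [funext hu_eq]
    exact hCA.sub hD
  have hmean : ∫ w, u w ∂P = n * R * Real.log 2 + (∑ i, min (l i) t) / (2 * t) -
      q.expDist S / (2 * t) := by
    rw [funext hu_eq, integral_sub hCA hD, integral_add (integrable_const _) hA,
      integral_div, integral_div, integral_finsetSum _ fun i _ => (hsq i).const_mul _]
    simp_rw [integral_const_mul, hsqv]
    simp [QuantScheme.expDist, ← hP]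
  -- Jensen's inequality in tangent form: `z + 1 ≤ exp z` at `z = u - log N`, integrated.
  have hlin : ∫ w, (u w - Real.log N + 1) ∂P ≤ ∫ w, Real.exp (u w) * (N : ℝ)⁻¹ ∂P := by
    refine integral_mono ((huint.sub (integrable_const _)).add (integrable_const _))
      (hexpint.mul_const _) fun w => ?_
    have h := Real.add_one_le_exp (u w - Real.log N)
    rwa [Real.exp_sub, Real.exp_log hN', div_eq_mul_inv] at h
  have hfin : ∫ w, u w ∂P - Real.log N + 1 ≤ 1 := by
    rw [integral_add (f := fun w => u w - Real.log N) (huint.sub (integrable_const _))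
      (integrable_const _), integral_sub huint (integrable_const _), integral_mul_const] at hlin
    have h3 : (∫ w, Real.exp (u w) ∂P) * (N : ℝ)⁻¹ ≤ 1 := by
      rw [← div_eq_mul_inv, div_le_one hN']
      exact hexp
    simp at hlin
    linarith
  have hgoal : (∑ i, min (l i) t) / (2 * t) ≤ q.expDist S / (2 * t) := by linarith
  have h2t : 0 < 2 * t := by linarith
  rw [wfDistAt, ← mul_assoc, mul_one_div_cancel hn'.ne', one_mul]
  exact (div_le_div_iff_of_pos_right h2t).1 hgoal

/-- Without a water level of rate `R` the bound degenerates: an encoder exists only if its codomain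
is nonempty, which forces `R ≥ 0`, and then all eigenvalues must vanish. -/
theorem wfDist_le_expDist {n : ℕ} (hn : 0 < n) {R : ℝ} {S : Matrix (Fin n) (Fin n) ℝ}
    (hS : S.PosSemidef) (q : QuantScheme n R) : (n : ℝ) * wfDist R hS ≤ q.expDist S := by
  have hn' : (0 : ℝ) < n := by exact_mod_cast hn
  by_cases h : ∃ t, 0 < t ∧ wfRateAt hS t = R
  · obtain ⟨t, ht, hR⟩ := h
    rw [wfDist_eq hS ht hR]
    exact wfDistAt_le_expDist hn hS ht hR q
  · have hR : 0 ≤ R := by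
      by_contra hR
      have h1 : ⌊(2 : ℝ) ^ ((n : ℝ) * R)⌋₊ = 0 :=
        Nat.floor_eq_zero.2 (Real.rpow_lt_one_of_one_lt_of_neg one_lt_two
          (mul_neg_of_pos_of_neg hn' (not_le.1 hR)))
      exact absurd (q.enc 0).pos (by omega)
    have h0 : ∀ j, hS.isHermitian.eigenvalues j = 0 := by
      intro j
      by_contra hj
      exact h (exists_wfRateAt_eq hS hR ((hS.eigenvalues_nonneg j).lt_of_ne' hj))
    rw [wfDist, dif_neg h, trace_eq_sum_eigenvalues_of_posSemidef hS]
    simp only [h0, Finset.sum_const_zero, zero_div, mul_zero]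
    exact integral_nonneg fun w => quadDist_nonneg hS _ _

/-! ### Greedy covering. -/

/-- **Greedy covering.** If every measurable set `F` can be met by one of the sets `A y` in a
`δ`-fraction of its excess over `η`, then `m` of these sets cover everything but a set of measure
`η + (1 - δ) ^ m`. The covering is presented as an encoder, where the index `0` (with the
default label `y₀`) stands for the uncovered points. -/
theorem exists_greedy_covering {Ω Y : Type*} [MeasurableSpace Ω] (μ : Measure Ω)
    [IsProbabilityMeasure μ] {A : Y → Set Ω} (hA : ∀ y, MeasurableSet (A y)) (y₀ : Y) {δ η : ℝ}
    (hδ : δ ≤ 1) (hη : 0 ≤ η)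
    (H : ∀ F, MeasurableSet F → ∃ y, δ * (μ.real F - η) ≤ μ.real (F ∩ A y)) (m : ℕ) :
    ∃ (enc : Ω → ℕ) (dec : ℕ → Y), Measurable enc ∧ (∀ w, enc w ≤ m) ∧ dec 0 = y₀ ∧
      (∀ w, enc w ≠ 0 → w ∈ A (dec (enc w))) ∧ μ.real {w | enc w = 0} ≤ η + (1 - δ) ^ m := by
  classical
  induction m with
  | zero => exact ⟨fun _ => 0, fun _ => y₀, measurable_const, by simp, rfl, by simp, by simpa⟩
  | succ m ih =>
    obtain ⟨enc, dec, henc, hm, h0, hcov, hμ⟩ := ih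
    have hF : MeasurableSet {w | enc w = 0} := henc (measurableSet_singleton 0)
    obtain ⟨y, hy⟩ := H _ hF
    have hFA := hF.inter (hA y)
    refine ⟨fun w => if w ∈ {w | enc w = 0} ∩ A y then m + 1 else enc w,
      Function.update dec (m + 1) y, Measurable.ite hFA measurable_const henc, fun w => ?_,
      by simp [h0], fun w hw => ?_, ?_⟩
    · dsimp only
      split_ifs
      · exact le_rfl
      · exact (hm w).trans (Nat.le_succ m)
    · dsimp only at hw ⊢
      split_ifs with h
      · simpa using h.2
      · rw [if_neg h] at hw
        have : enc w ≠ m + 1 := fun h' => by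
          have := hm w
          omega
        rw [Function.update_of_ne this]
        exact hcov w hw
    · have hset : {w | (if w ∈ {w | enc w = 0} ∩ A y then m + 1 else enc w) = 0} =
          {w | enc w = 0} \ A y := by
        ext w
        by_cases h1 : enc w = 0 <;> by_cases h2 : w ∈ A y <;> simp [h1, h2]
      rw [hset]
      have hsplit := measureReal_inter_add_sdiff (μ := μ) (s := {w | enc w = 0}) (hA y)
      rw [pow_succ']
      -- The new uncovered mass is at most `(1 - δ) μ(F) + δ η`, so the excess over `η` shrinks by
      -- the factor `1 - δ`.
      nlinarith [mul_le_mul_of_nonneg_left hμ (sub_nonneg.2 hδ)]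

/-! ### Change of measure and the Gaussian test channel. -/

theorem lintegral_pi_prod {n : ℕ} {μ : Fin n → Measure ℝ} [∀ i, IsProbabilityMeasure (μ i)]
    {f : Fin n → ℝ → ℝ≥0∞} (hf : ∀ i, Measurable (f i)) :
    ∫⁻ x, ∏ i, f i (x i) ∂Measure.pi μ = ∏ i, ∫⁻ x, f i x ∂μ i := by
  rw [lintegral_prod_eq_prod_lintegral_of_indepFun Finset.univ
    (fun i (x : Fin n → ℝ) => f i (x i)) (iIndepFun_pi fun i => (hf i).aemeasurable)
    fun i => (hf i).comp (measurable_pi_apply i)]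
  exact Finset.prod_congr rfl fun i _ =>
    (measurePreserving_eval μ i).lintegral_comp (hf i)

theorem pi_gaussianReal_eq_withDensity {n : ℕ} (y : Fin n → ℝ) {s : Fin n → ℝ≥0}
    (hs : ∀ i, s i ≠ 0) :
    Measure.pi (fun i => gaussianReal (y i) (s i)) =
      (piGaussian n).withDensity fun x => ∏ i, ENNReal.ofReal (gaussianRatio (y i) (s i) (x i)) := by
  refine Measure.pi_eq fun B hB => ?_
  have hm : ∀ i, Measurable fun x => ENNReal.ofReal (gaussianRatio (y i) (s i) x) := fun i =>
    (measurable_gaussianRatio _ _).ennreal_ofReal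
  have hbox : MeasurableSet (Set.univ.pi B) := MeasurableSet.univ_pi hB
  rw [withDensity_apply _ hbox, ← lintegral_indicator hbox]
  have hind : ∀ x : Fin n → ℝ, (Set.univ.pi B).indicator
      (fun x => ∏ i, ENNReal.ofReal (gaussianRatio (y i) (s i) (x i))) x =
      ∏ i, (B i).indicator (fun x => ENNReal.ofReal (gaussianRatio (y i) (s i) x)) (x i) := by
    intro x
    by_cases hx : x ∈ Set.univ.pi B
    · rw [Set.indicator_of_mem hx]
      exact Finset.prod_congr rfl fun i _ => by rw [Set.indicator_of_mem (hx i trivial)]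
    · rw [Set.indicator_of_notMem hx]
      simp only [Set.mem_pi, Set.mem_univ, true_implies, not_forall] at hx
      obtain ⟨i, hi⟩ := hx
      exact (Finset.prod_eq_zero (Finset.mem_univ i) (Set.indicator_of_notMem hi _)).symm
  simp_rw [hind]
  rw [lintegral_pi_prod fun i => (hm i).indicator (hB i)]
  refine Finset.prod_congr rfl fun i _ => ?_
  rw [lintegral_indicator (hB i), gaussianReal_eq_withDensity (y i) (hs i),
    withDensity_apply _ (hB i)]

theorem measurePreserving_add_sqrt_mul (y : ℝ) (s : ℝ≥0) :
    MeasurePreserving (fun v => y + √s * v) (gaussianReal 0 1) (gaussianReal y s) := by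
  refine ⟨by fun_prop, ?_⟩
  have h : (fun v : ℝ => y + √s * v) = (fun v => y + v) ∘ fun v => √(s : ℝ) * v := rfl
  rw [h, ← Measure.map_map (by fun_prop) (by fun_prop), gaussianReal_map_const_mul,
    gaussianReal_map_const_add]
  congr 1
  · simp
  · ext
    simp

/-- The vector `y + √s v` has density `∏ gaussianRatio` relative to the standard Gaussian. A bound
on this density over `G` compares the channel output law given the codeword with the unconditional
law. -/
theorem measure_preimage_le_of_gaussianRatio_le {n : ℕ} (y : Fin n → ℝ) {s : Fin n → ℝ≥0}
    (hs : ∀ i, s i ≠ 0) {G : Set (Fin n → ℝ)} (hG : MeasurableSet G) {K : ℝ}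
    (hK : ∀ w ∈ G, ∏ i, gaussianRatio (y i) (s i) (w i) ≤ K) :
    piGaussian n ((fun v i => y i + √(s i) * v i) ⁻¹' G) ≤ ENNReal.ofReal K * piGaussian n G := by
  have hmp := measurePreserving_pi (fun _ : Fin n => gaussianReal 0 1)
    (fun i => gaussianReal (y i) (s i)) fun i => measurePreserving_add_sqrt_mul (y i) (s i)
  rw [hmp.measure_preimage hG.nullMeasurableSet, pi_gaussianReal_eq_withDensity y hs,
    withDensity_apply _ hG, ← setLIntegral_const]
  refine setLIntegral_mono measurable_const fun w hw => ?_
  rw [← ENNReal.ofReal_prod_of_nonneg fun i _ => gaussianRatio_nonneg _ _ _]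
  exact ENNReal.ofReal_le_ofReal (hK w hw)

/-- The Gaussian test channel: combining two independent standard Gaussian vectors with
coefficients `√(1 - s i)` and `√(s i)` gives a standard Gaussian vector. -/
theorem measurePreserving_testChannel {n : ℕ} {s : Fin n → ℝ≥0} (hs : ∀ i, s i ≤ 1) :
    MeasurePreserving
      (fun (p : (Fin n → ℝ) × (Fin n → ℝ)) i => √(1 - s i) * p.1 i + √(s i) * p.2 i)
      ((piGaussian n).prod (piGaussian n)) (piGaussian n) := by
  have h1 : ∀ i, MeasurePreserving (fun p : ℝ × ℝ => √(1 - s i) * p.1 + √(s i) * p.2)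
      ((gaussianReal 0 1).prod (gaussianReal 0 1)) (gaussianReal 0 1) := by
    intro i
    have ha : MeasurePreserving (fun u => √(1 - s i) * u) (gaussianReal 0 1)
        (gaussianReal 0 (1 - s i)) := by
      have := measurePreserving_add_sqrt_mul 0 (1 - s i)
      simpa [NNReal.coe_sub (hs i)] using this
    have hb : MeasurePreserving (fun u => √(s i) * u) (gaussianReal 0 1)
        (gaussianReal 0 (s i)) := by
      simpa using measurePreserving_add_sqrt_mul 0 (s i)
    have hadd : MeasurePreserving (fun p : ℝ × ℝ => p.1 + p.2)
        ((gaussianReal 0 (1 - s i)).prod (gaussianReal 0 (s i))) (gaussianReal 0 1) := by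
      refine ⟨by fun_prop, ?_⟩
      have := gaussianReal_conv_gaussianReal (m₁ := 0) (m₂ := 0) (v₁ := 1 - s i) (v₂ := s i)
      rw [tsub_add_cancel_of_le (hs i), add_zero] at this
      exact this
    exact hadd.comp (ha.prod hb)
  have h2 := measurePreserving_pi (fun _ : Fin n => (gaussianReal 0 1).prod (gaussianReal 0 1))
    (fun _ => gaussianReal 0 1) h1
  have h3 := (measurePreserving_arrowProdEquivProdArrow ℝ ℝ (Fin n)
    (fun _ => gaussianReal 0 1) (fun _ => gaussianReal 0 1)).symm
  exact h2.comp h3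

/-- If the test channel lands in `A` up to probability `η`, and the information density is at most
`log K` on `A`, then some codeword captures a `K⁻¹`-fraction of the excess of `F` over `η`. -/
theorem exists_codeword_of_testChannel {n : ℕ} {s : Fin n → ℝ≥0} (hs0 : ∀ i, s i ≠ 0)
    (hs : ∀ i, s i ≤ 1) {A : Set ((Fin n → ℝ) × (Fin n → ℝ))} (hA : MeasurableSet A) {K η : ℝ}
    (hK0 : 0 < K)
    (hK : ∀ u w, (u, w) ∈ A → ∏ i, gaussianRatio (√(1 - s i) * u i) (s i) (w i) ≤ K)
    (hη : ((piGaussian n).prod (piGaussian n)).real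
      {p | (p.1, fun i => √(1 - s i) * p.1 i + √(s i) * p.2 i) ∉ A} ≤ η)
    {F : Set (Fin n → ℝ)} (hF : MeasurableSet F) :
    ∃ u, K⁻¹ * ((piGaussian n).real F - η) ≤ (piGaussian n).real (F ∩ Prod.mk u ⁻¹' A) := by
  have hmp := measurePreserving_testChannel hs
  set T : (Fin n → ℝ) × (Fin n → ℝ) → (Fin n → ℝ) :=
    fun p i => √(1 - s i) * p.1 i + √(s i) * p.2 i with hT
  have hTA : MeasurableSet {p : (Fin n → ℝ) × (Fin n → ℝ) | (p.1, T p) ∈ A} :=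
    (measurable_fst.prodMk hmp.measurable) hA
  have hE : MeasurableSet (T ⁻¹' F ∩ {p | (p.1, T p) ∈ A}) := (hmp.measurable hF).inter hTA
  -- First moment method: some `u` does at least as well as the average over the codeword
  -- distribution.
  obtain ⟨u, hu⟩ := exists_lintegral_le (μ := piGaussian n)
    (f := fun u => piGaussian n (Prod.mk u ⁻¹' (T ⁻¹' F ∩ {p | (p.1, T p) ∈ A})))
    (by rw [← Measure.prod_apply hE]; exact measure_ne_top _ _)
  rw [← Measure.prod_apply hE] at hu
  have hG : MeasurableSet (F ∩ Prod.mk u ⁻¹' A) := hF.inter (measurable_prodMk_left hA)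
  have h1 := measure_preimage_le_of_gaussianRatio_le (fun i => √(1 - s i) * u i) hs0 hG
    (K := K) fun w hw => hK u w hw.2
  have h2 := hu.trans h1
  have h3 : ((piGaussian n).prod (piGaussian n)).real (T ⁻¹' F ∩ {p | (p.1, T p) ∈ A}) ≤
      K * (piGaussian n).real (F ∩ Prod.mk u ⁻¹' A) := by
    have := ENNReal.toReal_mono (ENNReal.mul_ne_top ENNReal.ofReal_ne_top (measure_ne_top _ _)) h2
    rwa [ENNReal.toReal_mul, ENNReal.toReal_ofReal hK0.le] at this
  have h4 := measureReal_inter_add_sdiff (μ := (piGaussian n).prod (piGaussian n))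
    (s := T ⁻¹' F) hTA
  have h5 : ((piGaussian n).prod (piGaussian n)).real (T ⁻¹' F \ {p | (p.1, T p) ∈ A}) ≤ η :=
    (measureReal_mono fun p hp => hp.2).trans hη
  have h6 : ((piGaussian n).prod (piGaussian n)).real (T ⁻¹' F) = (piGaussian n).real F :=
    hmp.measureReal_preimage hF.nullMeasurableSet
  refine ⟨u, ?_⟩
  rw [inv_mul_le_iff₀ hK0]
  linarith

/-! ### Chi-squared tails. -/

/-- The integrand is a multiple of the density ratio of `N(0, 1/(1 - 2θ))`, so the integral equals
`exp (-θ - log (1 - 2θ) / 2)`; the Taylor remainder of the logarithm bounds the exponent. -/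
theorem integrable_exp_mul_sq_sub_one_and_integral_le {θ : ℝ} (hθ : |θ| ≤ 1 / 4) :
    Integrable (fun x => Real.exp (θ * (x ^ 2 - 1))) (gaussianReal 0 1) ∧
      ∫ x, Real.exp (θ * (x ^ 2 - 1)) ∂gaussianReal 0 1 ≤ Real.exp (4 * θ ^ 2) := by
  obtain ⟨h1, h2⟩ := abs_le.1 hθ
  have hpos : 0 < 1 - 2 * θ := by linarith
  set s : ℝ≥0 := ⟨(1 - 2 * θ)⁻¹, by positivity⟩ with hs
  have hs' : (s : ℝ) = (1 - 2 * θ)⁻¹ := rfl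
  have hs0 : s ≠ 0 := by
    rw [← NNReal.coe_ne_zero, hs']
    positivity
  have hfun : (fun x => Real.exp (θ * (x ^ 2 - 1))) =
      fun x => Real.exp (-θ - Real.log (1 - 2 * θ) / 2) * gaussianRatio 0 s x := by
    ext x
    have h3 : (√(s : ℝ))⁻¹ = Real.exp (Real.log (1 - 2 * θ) / 2) := by
      rw [hs', Real.sqrt_inv, inv_inv, ← Real.log_sqrt hpos.le, Real.exp_log]
      positivity
    rw [gaussianRatio, h3, ← Real.exp_add, ← Real.exp_add, hs']
    congr 1
    field_simp
    ring
  rw [hfun]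
  refine ⟨(integrable_gaussianRatio 0 hs0).const_mul _, ?_⟩
  rw [integral_const_mul, integral_gaussianRatio 0 hs0, mul_one, Real.exp_le_exp]
  have hz : |2 * θ| ≤ 1 / 2 := by
    rw [abs_mul, abs_two]
    linarith
  have h4 := Real.abs_log_sub_add_sum_range_le (x := 2 * θ) (by linarith) 1
  have h5 : |2 * θ| ^ (1 + 1) / (1 - |2 * θ|) ≤ 8 * θ ^ 2 := by
    rw [div_le_iff₀ (by linarith), one_add_one_eq_two, sq_abs]
    nlinarith [sq_nonneg θ]
  have h6 := (abs_le.1 (h4.trans h5)).1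
  simp at h6
  linarith

/-- Chernoff bound for both tails of a chi-squared variable (according to the sign of `θ`). -/
theorem measureReal_chiSq_tail_le {n : ℕ} (I : Finset (Fin n)) {θ : ℝ} (hθ : |θ| ≤ 1 / 4)
    (a : ℝ) :
    (piGaussian n).real {x | a ≤ θ * ∑ i ∈ I, (x i ^ 2 - 1)} ≤
      Real.exp (4 * n * θ ^ 2 - a) := by
  classical
  -- Coordinates outside `I` get the factor `1 ≤ exp (4 θ²)`, which makes the bound uniform in `I`,
  -- with `n` in place of its cardinality.
  set f : Fin n → ℝ → ℝ := fun i x => if i ∈ I then Real.exp (θ * (x ^ 2 - 1)) else 1 with hf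
  have hf0 : ∀ i x, 0 ≤ f i x := fun i x => by
    simp only [hf]
    split_ifs
    · positivity
    · exact zero_le_one
  have hfi : ∀ i, Integrable (f i) (gaussianReal 0 1) ∧
      ∫ x, f i x ∂gaussianReal 0 1 ≤ Real.exp (4 * θ ^ 2) := by
    intro i
    by_cases hi : i ∈ I
    · simpa only [hf, if_pos hi] using integrable_exp_mul_sq_sub_one_and_integral_le hθ
    · simp only [hf, if_neg hi]
      refine ⟨integrable_const _, ?_⟩
      simpa using (by positivity : 0 ≤ 4 * θ ^ 2)
  have hprod : ∀ x : Fin n → ℝ, Real.exp (θ * ∑ i ∈ I, (x i ^ 2 - 1)) = ∏ i, f i (x i) := by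
    intro x
    simp only [hf]
    rw [Finset.prod_ite_mem, Finset.univ_inter, Finset.mul_sum, Real.exp_sum]
  have hint : Integrable (fun x : Fin n → ℝ => ∏ i, f i (x i)) (piGaussian n) :=
    Integrable.fintype_prod fun i => (hfi i).1
  have hbound : ∫ x, ∏ i, f i (x i) ∂piGaussian n ≤ Real.exp (4 * n * θ ^ 2) := by
    rw [integral_fintype_prod_eq_prod f]
    calc ∏ i, ∫ x, f i x ∂gaussianReal 0 1 ≤ ∏ _i : Fin n, Real.exp (4 * θ ^ 2) :=
          Finset.prod_le_prod (fun i _ => integral_nonneg (hf0 i)) fun i _ => (hfi i).2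
      _ = Real.exp (4 * n * θ ^ 2) := by
          rw [Finset.prod_const, Finset.card_univ, Fintype.card_fin, ← Real.exp_nat_mul]
          ring_nf
  have hmarkov := mul_meas_ge_le_integral_of_nonneg
    (Filter.Eventually.of_forall fun x => Finset.prod_nonneg fun i _ => hf0 i (x i)) hint
    (Real.exp a)
  have hset : {x : Fin n → ℝ | a ≤ θ * ∑ i ∈ I, (x i ^ 2 - 1)} =
      {x | Real.exp a ≤ ∏ i, f i (x i)} := by
    ext x
    simp only [Set.mem_ofPred_eq, ← hprod, Real.exp_le_exp]
  rw [hset, Real.exp_sub, le_div_iff₀ (Real.exp_pos a), mul_comm]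
  exact hmarkov.trans hbound

/-! ### The codebook at a fixed water level and its expected distortion. -/

theorem gaussianRatio_eq_exp (y : ℝ) {s : ℝ≥0} (hs : s ≠ 0) (x : ℝ) :
    gaussianRatio y s x =
      Real.exp ((-Real.log s + x ^ 2 - (x - y) ^ 2 / s) / 2) := by
  have hs' : (0 : ℝ) < s := by positivity
  have h : (√(s : ℝ))⁻¹ = Real.exp (-Real.log s / 2) := by
    rw [neg_div, Real.exp_neg, ← Real.log_sqrt hs'.le, Real.exp_log (by positivity)]
  rw [gaussianRatio, h, ← Real.exp_add]
  congr 1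
  field_simp
  ring

/-- A codebook at water level `t`: all coordinates of weight at most `t` are dropped, the others
are reproduced within total distortion `t` per coordinate, except on a set of small measure on
which the encoder returns `0`. -/
theorem exists_codebook_at_level {n : ℕ} (l : Fin n → ℝ) {t : ℝ} (ht : 0 < t) {a θ : ℝ}
    (ha : 0 ≤ a) (hθ0 : 0 ≤ θ) (hθ : θ ≤ 1 / 4) (m : ℕ) :
    ∃ (enc : (Fin n → ℝ) → ℕ) (dec : ℕ → Fin n → ℝ), Measurable enc ∧ (∀ w, enc w ≤ m) ∧
      dec 0 = 0 ∧ (∀ j i, l i ≤ t → dec j i = 0) ∧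
      (∀ w, enc w ≠ 0 → ∑ i with t < l i, l i * (w i - dec (enc w) i) ^ 2 ≤
        ∑ i with t < l i, t) ∧
      (piGaussian n).real {w | enc w = 0} ≤ 3 * Real.exp (4 * n * θ ^ 2 - θ * a) +
        (1 - (Real.exp (∑ i, max 0 (Real.log (l i / t)) / 2 + 3 * a / 2))⁻¹) ^ m := by
  classical
  set I : Finset (Fin n) := Finset.univ.filter fun i => t < l i with hI
  have hmem : ∀ i, i ∈ I ↔ t < l i := fun i => by simp [hI]
  set k : ℝ := (I.card : ℝ) with hk
  have hk0 : 0 ≤ k := Nat.cast_nonneg _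
  -- The noise variance is reduced by the factor `1 + ε` so that a deviation `a` of the noise energy
  -- still leaves distortion `t / (1 + ε) * (a + k) = k * t`. If `k = 0`, then `ε = 0`.
  set ε : ℝ := a / k with hε
  have hε0 : 0 ≤ ε := div_nonneg ha hk0
  have hkε : k * ε ≤ a := by
    rcases hk0.eq_or_lt with h | h
    · rw [← h, zero_mul]
      exact ha
    · rw [hε, mul_div_cancel₀ _ h.ne']
  have hkε' : 0 < k → k * ε = a := fun h => by rw [hε, mul_div_cancel₀ _ h.ne']
  have hε1 : 0 < 1 + ε := by linarith
  -- Variance `1` on the dropped coordinates makes the codeword `0` and the density ratio `1` there.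
  set s : Fin n → ℝ≥0 := fun i => if t < l i then Real.toNNReal (t / ((1 + ε) * l i)) else 1
    with hs
  have hs_act : ∀ i, t < l i → (s i : ℝ) = t / ((1 + ε) * l i) := by
    intro i hi
    have : 0 < l i := ht.trans hi
    simp only [hs, if_pos hi]
    exact Real.coe_toNNReal _ (by positivity)
  have hs_in : ∀ i, ¬ t < l i → s i = 1 := fun i hi => by simp only [hs, if_neg hi]
  have hs0 : ∀ i, s i ≠ 0 := by
    intro i
    by_cases hi : t < l i
    · rw [← NNReal.coe_ne_zero, hs_act i hi]
      have : 0 < l i := ht.trans hi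
      positivity
    · rw [hs_in i hi]
      exact one_ne_zero
  have hs1 : ∀ i, s i ≤ 1 := by
    intro i
    by_cases hi : t < l i
    · rw [← NNReal.coe_le_coe, hs_act i hi, NNReal.coe_one]
      have : 0 < l i := ht.trans hi
      rw [div_le_one (by positivity)]
      nlinarith
    · rw [hs_in i hi]
  have hy0 : ∀ (u : Fin n → ℝ) i, ¬ t < l i → √(1 - s i) * u i = 0 := by
    intro u i hi
    rw [hs_in i hi]
    simp
  set V : (Fin n → ℝ) → (Fin n → ℝ) → ℝ := fun u w =>
    ∑ i ∈ I, ((w i - √(1 - s i) * u i) ^ 2 / s i - 1) with hV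
  set X : (Fin n → ℝ) → ℝ := fun w => ∑ i ∈ I, (w i ^ 2 - 1) with hX
  -- The upper bound on `V` controls the distortion; the lower bound on `V` and the upper bound on
  -- `X` control the information density. The density bound costs `a` from these two and `a / 2`
  -- from `log (1 + ε)`, whence `3 * a / 2` in `K`.
  set A : Set ((Fin n → ℝ) × (Fin n → ℝ)) :=
    {p | V p.1 p.2 ≤ a ∧ -a ≤ V p.1 p.2 ∧ X p.2 ≤ a} with hAdef
  have hVm : Measurable fun p : (Fin n → ℝ) × (Fin n → ℝ) => V p.1 p.2 := by
    simp only [hV]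
    fun_prop
  have hXm : Measurable X := by
    simp only [hX]
    fun_prop
  have hA : MeasurableSet A :=
    (measurableSet_le hVm measurable_const).inter
      ((measurableSet_le measurable_const hVm).inter
        (measurableSet_le (hXm.comp measurable_snd) measurable_const))
  set K : ℝ := Real.exp (∑ i, max 0 (Real.log (l i / t)) / 2 + 3 * a / 2) with hK
  have hK0 : 0 < K := Real.exp_pos _
  have hK1 : 1 ≤ K := by
    refine Real.one_le_exp (add_nonneg (Finset.sum_nonneg fun i _ => ?_) (by linarith))
    exact div_nonneg (le_max_left _ _) zero_le_two
  have hKA : ∀ u w, (u, w) ∈ A →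
      ∏ i, gaussianRatio (√(1 - s i) * u i) (s i) (w i) ≤ K := by
    rintro u w ⟨-, h2, h3⟩
    have hterm : ∀ i, gaussianRatio (√(1 - s i) * u i) (s i) (w i) =
        Real.exp (if i ∈ I then Real.log (l i / t) / 2 + Real.log (1 + ε) / 2 +
          ((w i ^ 2 - 1) - ((w i - √(1 - s i) * u i) ^ 2 / s i - 1)) / 2 else 0) := by
      intro i
      rw [gaussianRatio_eq_exp _ (hs0 i)]
      by_cases hi : t < l i
      · have hl : 0 < l i := ht.trans hi
        have hlog : -Real.log (s i) = Real.log (l i / t) + Real.log (1 + ε) := by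
          rw [← Real.log_inv, hs_act i hi, ← Real.log_mul (by positivity) (by positivity)]
          congr 1
          field_simp
        rw [if_pos ((hmem i).2 hi), hlog]
        congr 1
        ring
      · rw [if_neg (fun h => hi ((hmem i).1 h)), hy0 u i hi, hs_in i hi]
        simp
    simp_rw [hterm]
    rw [← Real.exp_sum, hK, Real.exp_le_exp, Finset.sum_ite_mem, Finset.univ_inter,
      Finset.sum_add_distrib, Finset.sum_add_distrib, ← Finset.sum_div I (fun i => _ - _),
      Finset.sum_sub_distrib]
    have e1 : ∑ i ∈ I, Real.log (l i / t) / 2 ≤ ∑ i, max 0 (Real.log (l i / t)) / 2 := by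
      refine (Finset.sum_le_sum fun i _ => ?_).trans
        (Finset.sum_le_sum_of_subset_of_nonneg (Finset.subset_univ I) fun i _ _ => ?_)
      · gcongr
        exact le_max_right _ _
      · exact div_nonneg (le_max_left _ _) zero_le_two
    have e2 : ∑ _i ∈ I, Real.log (1 + ε) / 2 ≤ a / 2 := by
      rw [Finset.sum_const, nsmul_eq_mul]
      have := Real.log_le_sub_one_of_pos hε1
      have : k * Real.log (1 + ε) ≤ k * ε := by
        gcongr
        linarith
      linarith
    have e3 : (∑ i ∈ I, (w i ^ 2 - 1) -
        ∑ i ∈ I, ((w i - √(1 - s i) * u i) ^ 2 / s i - 1)) / 2 ≤ a := by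
      change (X w - V u w) / 2 ≤ a
      linarith
    linarith
  set T : (Fin n → ℝ) × (Fin n → ℝ) → (Fin n → ℝ) :=
    fun p i => √(1 - s i) * p.1 i + √(s i) * p.2 i with hT
  have hmp : MeasurePreserving T ((piGaussian n).prod (piGaussian n)) (piGaussian n) :=
    measurePreserving_testChannel hs1
  -- Along the test channel the normalised error is the noise itself, so all three constraints in
  -- `A` are chi-squared tails.
  have hVT : ∀ p, V p.1 (T p) = X p.2 := by
    intro p
    simp only [hV, hX, hT]
    refine Finset.sum_congr rfl fun i _ => ?_
    have : (s i : ℝ) ≠ 0 := by exact_mod_cast hs0 i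
    rw [add_sub_cancel_left, mul_pow, Real.sq_sqrt (s i).coe_nonneg, mul_div_cancel_left₀ _ this]
  set b : ℝ := Real.exp (4 * n * θ ^ 2 - θ * a) with hb
  have hup : (piGaussian n).real {x | θ * a ≤ θ * X x} ≤ b :=
    measureReal_chiSq_tail_le I (by rwa [abs_of_nonneg hθ0]) (θ * a)
  have hlow : (piGaussian n).real {x | θ * a ≤ -θ * X x} ≤ b := by
    have := measureReal_chiSq_tail_le I (θ := -θ) (by rwa [abs_neg, abs_of_nonneg hθ0]) (θ * a)
    rwa [neg_sq] at this
  have hupm : MeasurableSet {x | θ * a ≤ θ * X x} :=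
    measurableSet_le measurable_const (hXm.const_mul _)
  have hlowm : MeasurableSet {x | θ * a ≤ -θ * X x} :=
    measurableSet_le measurable_const (hXm.const_mul _)
  have hη : ((piGaussian n).prod (piGaussian n)).real {p | (p.1, T p) ∉ A} ≤ 3 * b := by
    have hsub : {p | (p.1, T p) ∉ A} ⊆ (Prod.snd ⁻¹' {x | θ * a ≤ θ * X x} ∪
        Prod.snd ⁻¹' {x | θ * a ≤ -θ * X x}) ∪ T ⁻¹' {x | θ * a ≤ θ * X x} := by
      intro p hp
      by_contra hcon
      simp only [Set.mem_union, Set.mem_preimage, Set.mem_ofPred_eq, not_or, not_le] at hcon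
      obtain ⟨⟨c1, c2⟩, c3⟩ := hcon
      apply hp
      refine ⟨?_, ?_, ?_⟩
      · rw [hVT]
        exact (lt_of_mul_lt_mul_left c1 hθ0).le
      · rw [hVT]
        have : θ * (-X p.2) < θ * a := by linarith
        linarith [lt_of_mul_lt_mul_left this hθ0]
      · exact (lt_of_mul_lt_mul_left c3 hθ0).le
    have hsnd : MeasurePreserving Prod.snd ((piGaussian n).prod (piGaussian n)) (piGaussian n) :=
      measurePreserving_snd
    calc _ ≤ _ := measureReal_mono hsub
      _ ≤ _ := measureReal_union_le _ _
      _ ≤ _ := add_le_add_left (measureReal_union_le _ _) _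
      _ ≤ b + b + b := by
        rw [hsnd.measureReal_preimage hupm.nullMeasurableSet,
          hsnd.measureReal_preimage hlowm.nullMeasurableSet,
          hmp.measureReal_preimage hupm.nullMeasurableSet]
        gcongr
      _ = 3 * b := by ring
  obtain ⟨enc, dec, h1, h2, h3, h4, h5⟩ := exists_greedy_covering (piGaussian n)
    (A := fun u => Prod.mk u ⁻¹' A) (fun u => measurable_prodMk_left hA) (0 : Fin n → ℝ)
    (δ := K⁻¹) (η := 3 * b) (inv_le_one_of_one_le₀ hK1) (by positivity)
    (fun F hF => exists_codeword_of_testChannel hs0 hs1 hA hK0 hKA hη hF) m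
  refine ⟨enc, fun j i => √(1 - s i) * dec j i, h1, h2, ?_, fun j i hi => hy0 _ i hi.not_gt,
    fun w hw => ?_, h5⟩
  · ext i
    simp [h3]
  · have hwA := (h4 w hw).1
    rcases I.eq_empty_or_nonempty with hemp | hne
    · simp [hemp]
    have hkpos : 0 < k := by
      rw [hk]
      exact_mod_cast hne.card_pos
    have hsum : ∑ i ∈ I, l i * (w i - √(1 - s i) * dec (enc w) i) ^ 2 =
        t / (1 + ε) * (V (dec (enc w)) w + k) := by
      have hk' : k = ∑ _i ∈ I, (1 : ℝ) := by simp [hk]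
      simp only [hV]
      rw [hk', ← Finset.sum_add_distrib, Finset.mul_sum]
      refine Finset.sum_congr rfl fun i hi => ?_
      have hi' := (hmem i).1 hi
      have hl : 0 < l i := ht.trans hi'
      rw [hs_act i hi']
      field_simp
      ring
    rw [hsum, Finset.sum_const, nsmul_eq_mul, ← hk]
    calc t / (1 + ε) * (V (dec (enc w)) w + k) ≤ t / (1 + ε) * (a + k) := by
          have : V (dec (enc w)) w ≤ a := hwA
          gcongr
      _ = k * t := by
          rw [← hkε' hkpos]
          field_simp
          ring

/-- On the uncovered set the decoder returns `0`, and `wᵢ²` is bounded there by `(δ wᵢ⁴ + 1/δ) / 2`.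
This weighted AM-GM inequality replaces Cauchy-Schwarz; `δ` is to be of the order of the square root
of the uncovered mass. -/
theorem integral_codebook_le {n : ℕ} {l : Fin n → ℝ} (hl : ∀ i, 0 ≤ l i) {t : ℝ}
    {enc : (Fin n → ℝ) → ℕ} {dec : ℕ → Fin n → ℝ} (henc : Measurable enc) (h0 : dec 0 = 0)
    (hdrop : ∀ j i, l i ≤ t → dec j i = 0)
    (hgood : ∀ w, enc w ≠ 0 → ∑ i with t < l i, l i * (w i - dec (enc w) i) ^ 2 ≤
      ∑ i with t < l i, t) (ht : 0 < t) {δ : ℝ} (hδ : 0 < δ) :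
    ∫ w, ∑ i, l i * (w i - dec (enc w) i) ^ 2 ∂piGaussian n ≤ ∑ i, min (l i) t +
      (∑ i, l i) * ((δ * ∫ x, x ^ 4 ∂gaussianReal 0 1) +
        (piGaussian n).real {w | enc w = 0} / δ) / 2 := by
  classical
  set F : Set (Fin n → ℝ) := {w | enc w = 0} with hF
  have hFm : MeasurableSet F := henc (measurableSet_singleton 0)
  have hsplit : ∀ f : Fin n → ℝ, ∑ i, f i = ∑ i with t < l i, f i + ∑ i with ¬ t < l i, f i :=
    fun f => (Finset.sum_filter_add_sum_filter_not _ _ _).symm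
  set g : (Fin n → ℝ) → ℝ := fun w => (∑ i with t < l i, t + ∑ i with ¬ t < l i, l i * w i ^ 2) +
    ∑ i, l i * ((δ * w i ^ 4 + F.indicator 1 w / δ) / 2) with hg
  have hamgm : ∀ (w : Fin n → ℝ) i, w ∈ F →
      w i ^ 2 ≤ (δ * w i ^ 4 + F.indicator 1 w / δ) / 2 := by
    intro w i hw
    rw [Set.indicator_of_mem hw, Pi.one_apply]
    have : (δ * w i ^ 4 + 1 / δ) / 2 - w i ^ 2 = (δ * w i ^ 2 - 1) ^ 2 / (2 * δ) := by
      field_simp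
      ring
    have h2 : 0 ≤ (δ * w i ^ 2 - 1) ^ 2 / (2 * δ) := by positivity
    linarith
  have hpos : ∀ (w : Fin n → ℝ) i, 0 ≤ l i * ((δ * w i ^ 4 + F.indicator 1 w / δ) / 2) := by
    intro w i
    have h1 : (0 : ℝ) ≤ F.indicator 1 w := Set.indicator_nonneg (fun _ _ => zero_le_one) w
    have := hl i
    positivity
  have hle : ∀ w, ∑ i, l i * (w i - dec (enc w) i) ^ 2 ≤ g w := by
    intro w
    have hin : ∑ i with ¬ t < l i, l i * (w i - dec (enc w) i) ^ 2 =
        ∑ i with ¬ t < l i, l i * w i ^ 2 := by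
      refine Finset.sum_congr rfl fun i hi => ?_
      rw [hdrop _ i (not_lt.1 (Finset.mem_filter.1 hi).2), sub_zero]
    rw [hsplit, hin, hg]
    by_cases hw : w ∈ F
    · have hw' : enc w = 0 := hw
      have h1 : ∑ i with t < l i, l i * (w i - dec (enc w) i) ^ 2 ≤
          ∑ i, l i * ((δ * w i ^ 4 + F.indicator 1 w / δ) / 2) := by
        refine (Finset.sum_le_sum fun i _ => ?_).trans (Finset.sum_le_sum_of_subset_of_nonneg
          (Finset.filter_subset _ _) fun i _ _ => hpos w i)
        rw [hw', h0, Pi.zero_apply, sub_zero]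
        exact mul_le_mul_of_nonneg_left (hamgm w i hw) (hl i)
      have h2 : 0 ≤ ∑ i with t < l i, t := Finset.sum_nonneg fun _ _ => ht.le
      dsimp only
      linarith
    · have h1 := hgood w hw
      have h2 : 0 ≤ ∑ i, l i * ((δ * w i ^ 4 + F.indicator 1 w / δ) / 2) :=
        Finset.sum_nonneg fun i _ => hpos w i
      dsimp only
      linarith
  have hi1 : Integrable (fun w : Fin n → ℝ => ∑ i with ¬ t < l i, l i * w i ^ 2)
      (piGaussian n) :=
    integrable_finsetSum _ fun i _ => (integrable_eval_pow_piGaussian 2 i).const_mul _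
  have hi2 : Integrable (fun w : Fin n → ℝ => ∑ i with t < l i, t +
      ∑ i with ¬ t < l i, l i * w i ^ 2) (piGaussian n) := (integrable_const _).add hi1
  have hiF : Integrable (F.indicator (1 : (Fin n → ℝ) → ℝ)) (piGaussian n) :=
    (integrable_const (1 : ℝ)).indicator hFm
  have hi4 : ∀ i, Integrable (fun w : Fin n → ℝ => δ * w i ^ 4) (piGaussian n) := fun i =>
    (integrable_eval_pow_piGaussian 4 i).const_mul _
  have hi3 : ∀ i, Integrable (fun w : Fin n → ℝ =>
      l i * ((δ * w i ^ 4 + F.indicator 1 w / δ) / 2)) (piGaussian n) := fun i =>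
    (((hi4 i).add (hiF.div_const δ)).div_const 2).const_mul _
  have hi3s := integrable_finsetSum Finset.univ fun i _ => hi3 i
  have hval : ∫ w, g w ∂piGaussian n = ∑ i, min (l i) t +
      (∑ i, l i) * ((δ * ∫ x, x ^ 4 ∂gaussianReal 0 1) +
        (piGaussian n).real {w | enc w = 0} / δ) / 2 := by
    rw [hg, integral_add hi2 hi3s, integral_add (integrable_const _) hi1,
      integral_finsetSum _ fun i _ => (integrable_eval_pow_piGaussian 2 i).const_mul _,
      integral_finsetSum _ fun i _ => hi3 i]
    have e1 : ∀ i, ∫ w : Fin n → ℝ, l i * w i ^ 2 ∂piGaussian n = l i := by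
      intro i
      rw [integral_const_mul, integral_eval_piGaussian i (f := fun x => x ^ 2) (by fun_prop),
        integral_sq_gaussianReal, mul_one]
    have e2 : ∀ i, ∫ w : Fin n → ℝ, l i * ((δ * w i ^ 4 + F.indicator 1 w / δ) / 2)
        ∂piGaussian n = l i * (((δ * ∫ x, x ^ 4 ∂gaussianReal 0 1) +
          (piGaussian n).real F / δ) / 2) := by
      intro i
      rw [integral_const_mul, integral_div, integral_add (hi4 i) (hiF.div_const δ),
        integral_const_mul, integral_eval_piGaussian i (f := fun x => x ^ 4) (by fun_prop),
        integral_div, integral_indicator_one hFm]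
    simp_rw [e1, e2]
    rw [← Finset.sum_mul, hsplit fun i => min (l i) t, mul_div_assoc]
    congr 2
    · rw [integral_const, probReal_univ, one_smul]
      exact Finset.sum_congr rfl fun i hi => (min_eq_right (Finset.mem_filter.1 hi).2.le).symm
    · exact Finset.sum_congr rfl fun i hi =>
        (min_eq_left (not_lt.1 (Finset.mem_filter.1 hi).2)).symm
  rw [← hval]
  refine integral_mono_of_nonneg (Filter.Eventually.of_forall fun w => ?_) (hi2.add hi3s)
    (Filter.Eventually.of_forall hle)
  exact Finset.sum_nonneg fun i _ => mul_nonneg (hl i) (sq_nonneg _)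

/-! ### Compression schemes and the choice of parameters. -/

/-- A codebook in eigencoordinates gives a compression scheme with the same distortion. -/
theorem exists_scheme_of_codebook {n : ℕ} {R : ℝ} {S : Matrix (Fin n) (Fin n) ℝ}
    (hS : S.PosSemidef) {enc : (Fin n → ℝ) → ℕ} (dec : ℕ → Fin n → ℝ) (henc : Measurable enc)
    (hlt : ∀ w, enc w < ⌊(2 : ℝ) ^ ((n : ℝ) * R)⌋₊) :
    ∃ q : QuantScheme n R, q.expDist S =
      ∫ w, ∑ i, hS.isHermitian.eigenvalues i * (w i - dec (enc w) i) ^ 2 ∂piGaussian n := by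
  obtain ⟨e, he, hd⟩ := exists_measurableEquiv_quadDist hS
  refine ⟨⟨fun w => ⟨enc (e w), hlt _⟩, fun j => e.symm (dec j), ?_⟩, ?_⟩
  · refine measurable_to_countable' fun j => ?_
    have : (fun w => (⟨enc (e w), hlt _⟩ : Fin ⌊(2 : ℝ) ^ ((n : ℝ) * R)⌋₊)) ⁻¹' {j} =
        (fun w => enc (e w)) ⁻¹' {(j : ℕ)} := by
      ext w
      simp [Fin.ext_iff]
    rw [this]
    exact (henc.comp e.measurable) (measurableSet_singleton _)
  · rw [QuantScheme.expDist, ← he.integral_comp' (f := e)]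
    simp [hd]

theorem one_le_floor_two_rpow (n : ℕ) {R : ℝ} (hR : 0 ≤ R) :
    1 ≤ ⌊(2 : ℝ) ^ ((n : ℝ) * R)⌋₊ :=
  Nat.le_floor (by simpa using Real.one_le_rpow one_le_two (by positivity : 0 ≤ (n : ℝ) * R))

/-- One message, decoded to `0`. This handles `n = 1` and rates without a water level. -/
theorem exists_scheme_expDist_eq_trace {n : ℕ} {R : ℝ} (hR : 0 ≤ R)
    {S : Matrix (Fin n) (Fin n) ℝ} (hS : S.PosSemidef) :
    ∃ q : QuantScheme n R, q.expDist S = S.trace := by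
  obtain ⟨q, hq⟩ := exists_scheme_of_codebook (R := R) hS (enc := fun _ => 0) (fun _ => 0)
    measurable_const fun _ => one_le_floor_two_rpow n hR
  refine ⟨q, hq.trans ?_⟩
  simp only [Pi.zero_apply, sub_zero]
  rw [integral_finsetSum _ fun i _ => (integrable_eval_pow_piGaussian 2 i).const_mul _,
    trace_eq_sum_eigenvalues_of_posSemidef hS]
  refine Finset.sum_congr rfl fun i _ => ?_
  rw [integral_const_mul, integral_eval_piGaussian i (f := fun x => x ^ 2) (by fun_prop),
    integral_sq_gaussianReal, mul_one]

/-- Given a rate surplus of order `√(log n / n)` over the rate of the water level `t`, its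
distortion is achieved up to a term of order `n ^ (-B)`. -/
theorem exists_scheme_at_level {B : ℝ} (hB : 0 < B) {c : ℝ}
    (hc : 3 * (8 * B + 1) + 2 * (2 * B + 2) ≤ c) {n : ℕ} (hn : 2 ≤ n) {R : ℝ}
    {S : Matrix (Fin n) (Fin n) ℝ} (hS : S.PosSemidef) {t : ℝ} (ht : 0 < t)
    (hRt : wfRateAt hS t = R - c * √(Real.logb 2 n / n)) :
    ∃ q : QuantScheme n R, q.expDist S ≤ n * wfDistAt hS t +
      ((∫ x, x ^ 4 ∂gaussianReal 0 1) + 4) / 2 * (n : ℝ) ^ (-B) * S.trace := by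
  have hn2 : (2 : ℝ) ≤ n := by exact_mod_cast hn
  have hn0 : (0 : ℝ) < n := by linarith
  set ℓ : ℝ := Real.log n with hℓ
  have hlog2 : 1 / 2 ≤ Real.log 2 := by linarith [Real.log_two_gt_d9]
  have hlog2' : Real.log 2 ≤ 1 := by linarith [Real.log_two_lt_d9]
  have hℓ2 : 1 / 2 ≤ ℓ := hlog2.trans (Real.log_le_log two_pos hn2)
  have hℓn : ℓ ≤ n := (Real.log_le_sub_one_of_pos hn0).trans (by linarith)
  set σ : ℝ := √(n * ℓ) with hσ
  have hσ2 : σ ^ 2 = n * ℓ := Real.sq_sqrt (by positivity)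
  have hσ0 : 0 ≤ σ := Real.sqrt_nonneg _
  have hσℓ : ℓ ≤ σ := Real.le_sqrt_of_sq_le (by nlinarith)
  have hσ1 : 1 / 2 ≤ σ := hℓ2.trans hσℓ
  have hsqrt : n * √(ℓ / n) = σ := by
    rw [hσ, show (n : ℝ) * ℓ = n ^ 2 * (ℓ / n) by field_simp,
      Real.sqrt_mul (by positivity), Real.sqrt_sq hn0.le]
  set θ : ℝ := √(ℓ / n) / 4 with hθ
  have hθ0 : 0 ≤ θ := by positivity
  have hθ1 : θ ≤ 1 / 4 := by
    have : √(ℓ / n) ≤ 1 := Real.sqrt_le_one.2 ((div_le_one hn0).2 hℓn)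
    rw [hθ]
    linarith
  have hθ2 : 4 * n * θ ^ 2 = ℓ / 4 := by
    rw [hθ, div_pow, Real.sq_sqrt (by positivity)]
    field_simp
  have hθσ : θ * σ = ℓ / 4 := by
    have h : θ = σ / n / 4 := by
      rw [hθ, ← hsqrt]
      field_simp
    rw [h, show σ / n / 4 * σ = σ ^ 2 / n / 4 by ring, hσ2]
    field_simp
  -- Since `4 n θ² = θ σ = ℓ / 4`, this `a` makes the Chernoff exponent `4 n θ² - θ a` equal to `-2
  -- B ℓ`.
  set a : ℝ := (8 * B + 1) * σ with ha
  have ha0 : 0 ≤ a := by positivity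
  set N := ⌊(2 : ℝ) ^ ((n : ℝ) * R)⌋₊ with hN
  -- Index `0` uses up one of the `N` messages.
  obtain ⟨enc, dec, h1, h2, h3, h4, h5, h6⟩ := exists_codebook_at_level
    (hS.isHermitian.eigenvalues) ht ha0 hθ0 hθ1 (N - 1)
  rw [sum_max_zero_log_eq (by omega) hS t] at h6
  set K : ℝ := Real.exp (n * wfRateAt hS t * Real.log 2 + 3 * a / 2) with hK
  have hrate : 0 ≤ wfRateAt hS t :=
    mul_nonneg (by positivity) (Finset.sum_nonneg fun i _ => le_max_left _ _)
  have hK1 : 1 ≤ K := Real.one_le_exp (by positivity)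
  -- `2 B ℓ K` codewords bring the covering error down to `exp (-2 B ℓ)`; the summand `2` absorbs
  -- the floor and the index `0`.
  have hpow : K * (2 * B * ℓ + 2) ≤ (2 : ℝ) ^ ((n : ℝ) * R) := by
    have e1 : σ / 2 ≤ n * √(Real.logb 2 n / n) * Real.log 2 := by
      have : √(ℓ / n) ≤ √(Real.logb 2 n / n) := by
        refine Real.sqrt_le_sqrt ?_
        gcongr
        rw [Real.logb]
        exact le_div_self (by linarith) (by linarith) hlog2'
      calc σ / 2 = n * √(ℓ / n) * (1 / 2) := by rw [hsqrt]; ring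
        _ ≤ _ := by gcongr
    -- The surplus is at least `c σ / 2` nats, which pays for `3 a / 2` in `K` and for `(2 B + 2)
    -- σ`; the exponential of the latter exceeds `2 B ℓ + 2` because `σ ≥ ℓ` and `σ ≥ 1 / 2`.
    have e2 : n * wfRateAt hS t * Real.log 2 + 3 * a / 2 + (2 * B + 2) * σ ≤
        Real.log 2 * (n * R) := by
      have : R = wfRateAt hS t + c * √(Real.logb 2 n / n) := by rw [hRt]; ring
      rw [this]
      have e3 : (3 * (8 * B + 1) + 2 * (2 * B + 2)) * (σ / 2) ≤
          c * (n * √(Real.logb 2 n / n) * Real.log 2) := by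
        gcongr
        exact le_trans (by positivity) hc
      rw [ha]
      linarith
    rw [Real.rpow_def_of_pos two_pos]
    refine le_trans ?_ (Real.exp_le_exp.2 e2)
    rw [Real.exp_add]
    refine mul_le_mul_of_nonneg_left ?_ (by positivity)
    have := Real.add_one_le_exp ((2 * B + 2) * σ)
    nlinarith
  have hm : 2 * B * ℓ * K ≤ ((N - 1 : ℕ) : ℝ) := by
    have e1 : (2 : ℝ) ^ ((n : ℝ) * R) < N + 1 := Nat.lt_floor_add_one _
    have e2 : (N : ℝ) ≤ ((N - 1 : ℕ) : ℝ) + 1 := by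
      have : N ≤ N - 1 + 1 := by omega
      exact_mod_cast this
    nlinarith
  have hN1 : 1 ≤ N := by
    have e1 : (2 : ℝ) ^ ((n : ℝ) * R) < N + 1 := Nat.lt_floor_add_one _
    have e2 : 2 ≤ K * (2 * B * ℓ + 2) := by
      have : 0 ≤ 2 * B * ℓ := by positivity
      nlinarith
    have e3 : (1 : ℝ) < N := by linarith
    exact_mod_cast e3.le
  set δ : ℝ := (n : ℝ) ^ (-B) with hδ
  have hδ0 : 0 < δ := by positivity
  have hδexp : δ ^ 2 = Real.exp (-(2 * B * ℓ)) := by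
    rw [hδ, Real.rpow_def_of_pos hn0, ← Real.exp_nat_mul]
    congr 1
    push_cast
    ring
  have htail : Real.exp (4 * n * θ ^ 2 - θ * a) = δ ^ 2 := by
    rw [hδexp, hθ2, ha, show θ * ((8 * B + 1) * σ) = (8 * B + 1) * (θ * σ) by ring, hθσ]
    congr 1
    ring
  have hcover : (1 - K⁻¹) ^ (N - 1) ≤ δ ^ 2 := by
    have e1 : 1 - K⁻¹ ≤ Real.exp (-K⁻¹) := by linarith [Real.add_one_le_exp (-K⁻¹)]
    have e2 : 0 ≤ 1 - K⁻¹ := sub_nonneg.2 (inv_le_one_of_one_le₀ hK1)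
    calc (1 - K⁻¹) ^ (N - 1) ≤ Real.exp (-K⁻¹) ^ (N - 1) := by gcongr
      _ = Real.exp (((N - 1 : ℕ) : ℝ) * -K⁻¹) := (Real.exp_nat_mul _ _).symm
      _ ≤ δ ^ 2 := by
        rw [hδexp, Real.exp_le_exp, mul_neg, neg_le_neg_iff, ← div_eq_mul_inv,
          le_div_iff₀ (by positivity)]
        exact hm
  -- The uncovered mass is at most `4 δ²`: three tails and the covering error.
  have hp : (piGaussian n).real {w | enc w = 0} / δ ≤ 4 * δ := by
    rw [div_le_iff₀ hδ0]
    rw [htail] at h6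
    rw [mul_assoc, ← sq]
    linarith
  obtain ⟨q, hq⟩ := exists_scheme_of_codebook (R := R) hS dec h1 fun w => by
    have := h2 w
    omega
  refine ⟨q, hq.trans_le ?_⟩
  have hmain := integral_codebook_le (fun i => hS.eigenvalues_nonneg i) h1 h3 h4 h5 ht hδ0
  refine hmain.trans ?_
  rw [← trace_eq_sum_eigenvalues_of_posSemidef hS, wfDistAt, ← mul_assoc,
    mul_one_div_cancel hn0.ne', one_mul]
  have htr : 0 ≤ S.trace := hS.trace_nonneg
  have : S.trace * (δ * (∫ x, x ^ 4 ∂gaussianReal 0 1) +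
      (piGaussian n).real {w | enc w = 0} / δ) / 2 ≤
      S.trace * (δ * (∫ x, x ^ 4 ∂gaussianReal 0 1) + 4 * δ) / 2 := by gcongr
  linarith

theorem exists_scheme_expDist_le {B : ℝ} (hB : 0 < B) {c : ℝ}
    (hc : 3 * (8 * B + 1) + 2 * (2 * B + 2) ≤ c)
    (hc' : ((∫ x, x ^ 4 ∂gaussianReal 0 1) + 4) / 2 ≤ c) {n : ℕ} (hn : 0 < n) {R : ℝ}
    (hR : 0 ≤ R) {S : Matrix (Fin n) (Fin n) ℝ} (hS : S.PosSemidef) :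
    ∃ q : QuantScheme n R, q.expDist S ≤
      n * wfDist (R - c * √(Real.logb 2 n / n)) hS + c * (n : ℝ) ^ (-B) * S.trace := by
  have htr : 0 ≤ S.trace := hS.trace_nonneg
  have hn0 : (0 : ℝ) < n := by exact_mod_cast hn
  have hc1 : 1 ≤ c := by linarith
  by_cases h : ∃ t, 0 < t ∧ wfRateAt hS t = R - c * √(Real.logb 2 n / n)
  · obtain ⟨t, ht, hRt⟩ := h
    rw [wfDist_eq hS ht hRt]
    -- For `n = 1` there is no rate surplus, but the error term is `c * S.trace` with `c ≥ 1`.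
    rcases Nat.lt_or_ge n 2 with hn2 | hn2
    · obtain rfl : n = 1 := by omega
      obtain ⟨q, hq⟩ := exists_scheme_expDist_eq_trace hR hS
      refine ⟨q, hq.trans_le ?_⟩
      have h0 : 0 ≤ wfDistAt hS t := mul_nonneg (by positivity)
        (Finset.sum_nonneg fun i _ => le_min (hS.eigenvalues_nonneg i) ht.le)
      simp only [Nat.cast_one, Real.one_rpow, mul_one, one_mul]
      nlinarith
    · obtain ⟨q, hq⟩ := exists_scheme_at_level hB hc hn2 hS ht hRt
      refine ⟨q, hq.trans ?_⟩
      gcongr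
  · obtain ⟨q, hq⟩ := exists_scheme_expDist_eq_trace hR hS
    refine ⟨q, hq.trans_le ?_⟩
    rw [wfDist, dif_neg h, mul_div_cancel₀ _ hn0.ne']
    have : 0 ≤ c * (n : ℝ) ^ (-B) * S.trace := by positivity
    linarith

theorem mainTheorem6 :
    (∀ (n : ℕ), 0 < n → ∀ (R : ℝ) (S : Matrix (Fin n) (Fin n) ℝ) (hS : S.PosSemidef)
      (q : QuantScheme n R), (n : ℝ) * wfDist R hS ≤ q.expDist S) ∧
    (∀ B : ℝ, 0 < B → ∃ c : ℝ, 0 < c ∧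
      ∀ (n : ℕ), 0 < n → ∀ (R : ℝ), 0 ≤ R →
        ∀ (S : Matrix (Fin n) (Fin n) ℝ) (hS : S.PosSemidef),
          ∃ q : QuantScheme n R,
            q.expDist S ≤
              (n : ℝ) * wfDist (R - c * Real.sqrt (Real.logb 2 n / n)) hS +
                c * (n : ℝ) ^ (-B) * S.trace) := by
  refine ⟨fun n hn R S hS q => wfDist_le_expDist hn hS q, fun B hB => ?_⟩
  have hc : 0 < 3 * (8 * B + 1) + 2 * (2 * B + 2) := by positivity
  exact ⟨max (3 * (8 * B + 1) + 2 * (2 * B + 2)) (((∫ x, x ^ 4 ∂gaussianReal 0 1) + 4) / 2),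
    hc.trans_le (le_max_left _ _), fun n hn R hR S hS =>
      exists_scheme_expDist_le hB (le_max_left _ _) (le_max_right _ _) hn hR hS⟩
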